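/- Notation. For an integer $n\ge 0$ put $[n]=\{0,1,\dots,n\}$. For $\underline r=(r_1,\dots,r_m)$ with $r_j\in\mathbb Z_{\ge 0}$, let $\square_{\underline r}=\prod_{j=1}^m [r_j]$ be the hypercuboid of width $\underline r$, with the coordinatewise order $\le$, join $\vee$ and meet $\wedge$; $t\,\underline e_i$ denotes the point whose $i$-th coordinate is $t$ and whose other coordinates are $0$. A *matricube* $\mathcal M$ with ground set $\square_{\underline r}$ is given by a rank function $\mathrm{rk}\colon\square_{\underline r}\to\mathbb Z_{\ge0}$ such that $\mathrm{rk}(\underline 0)=0$; $\mathrm{rk}(t\,\underline e_i)-\mathrm{rk}((t-1)\,\underline e_i)\le 1$ for all $1\le i\le m$ and $1\le t\le r_i$; $\mathrm{rk}$ is non-decreasing; and $\mathrm{rk}(\underline x\vee\underline y)+\mathrm{rk}(\underline x\wedge\underline y)\le\mathrm{rk}(\underline x)+\mathrm{rk}(\underline y)$ for all $\underline x,\underline y$. An *initial flag* of length $\ell$ in a finite-dimensional $\Bbbk$-vector space $V$ is a chain of subspaces $V=F^0\supseteq F^1\supseteq\dots\supseteq F^{\ell}\supsetneq(0)$ in which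 each $F^t$ has codimension $0$ or $1$ in $F^{t-1}$. The matricube $\mathcal M$ is *representable over $\Bbbk$* if there are a finite-dimensional $\Bbbk$-vector space $V$ and initial flags $F_1^\bullet,\dots,F_m^\bullet$ of lengths $r_1,\dots,r_m$ in $V$ with $\mathrm{rk}(\underline x)=\operatorname{codim}_V\bigl(F_1^{x_1}\cap\dots\cap F_m^{x_m}\bigr)$ for all $\underline x\in\square_{\underline r}$. A matroid on a set $X$ is *representable over $\Bbbk$* if there are vectors $v_x$, $x\in X$, in a $\Bbbk$-vector space such that a subset $I\subseteq X$ is independent if and only if the family $(v_x)_{x\in I}$ is linearly independent. The *natural polymatroid* of $\mathcal M$ is the integer polymatroid on $E=[r_1]\sqcup\dots\sqcup[r_m]$ with rank function $\rho(S)=\mathrm{rk}\bigl(\bigvee_{(i,t)\in S}t\,\underline e_i\bigr)$, where $(i,t)$ is the element $t$ of the $i$-th interval. The *natural matroid* of $\mathcal M$ is the matroid on the set $\widehat E$ obtained from $E$ by replacing each $e\in E$ with $\rho(\{e\})$ copies of it, with rank function $$\widehat\rho(Y)=\min_{S\subseteq E}\bigl(\rho(S)+|Y\setminus\widehat S|\bigr),\qquad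 Y\subseteq\widehat E,$$ where $\widehat S\subseteq\widehat E$ is the set of all copies of elements of $S$. **Theorem.** Let $\underline r=(r_1,\dots,r_m)$ be a tuple of non-negative integers. (1) Let $\mathcal M$ be a matricube with ground set $\square_{\underline r}$ and let $\Bbbk$ be an infinite field. Then $\mathcal M$ is representable over $\Bbbk$ if and only if its natural matroid is representable over $\Bbbk$. (2) There is an integer $N$, depending only on $\underline r$, such that the same equivalence holds for every matricube $\mathcal M$ with ground set $\square_{\underline r}$ and every finite field $\Bbbk$ with at least $N$ elements. -/

import Mathlib

universe u

namespace Matricubes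

/-! ### Hypercuboids and matricubes -/

/-- The hypercuboid `∏ j, {0, …, r j}` of width `r`, with its coordinatewise order, join and
meet. The point `t e_i` is `Pi.single i t`. -/
abbrev Hypercuboid {m : ℕ} (r : Fin m → ℕ) : Type := ∀ j : Fin m, Fin (r j + 1)

/-- A matricube with ground set the hypercuboid of width `r`, given by its rank function. -/
structure Matricube {m : ℕ} (r : Fin m → ℕ) where
  rk : Hypercuboid r → ℕ
  rk_zero : rk 0 = 0
  rk_step : ∀ (i : Fin m) (t : Fin (r i)),
    rk (Pi.single i t.succ) ≤ rk (Pi.single i t.castSucc) + 1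
  rk_mono : ∀ x y : Hypercuboid r, x ≤ y → rk x ≤ rk y
  rk_submod : ∀ x y : Hypercuboid r, rk (x ⊔ y) + rk (x ⊓ y) ≤ rk x + rk y

/-! ### Flag arrangements and representable matricubes -/

/-- An initial decreasing flag `V = F 0 ⊇ F 1 ⊇ ⋯ ⊇ F ℓ ⊋ 0` of length `ℓ`, in which each subspace
has codimension `0` or `1` in the preceding one. -/
structure InitialFlag (k V : Type*) [Field k] [AddCommGroup V] [Module k V] (ℓ : ℕ) where
  F : Fin (ℓ + 1) → Submodule k V
  zero_eq : F 0 = ⊤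
  succ_le : ∀ t : Fin ℓ, F t.succ ≤ F t.castSucc
  codim_le : ∀ t : Fin ℓ, Module.finrank k (F t.castSucc) ≤ Module.finrank k (F t.succ) + 1
  last_ne : F (Fin.last ℓ) ≠ ⊥

/-- The matricube is the one associated to an arrangement of initial flags of lengths
`r 0, …, r (m - 1)` in a finite-dimensional `k`-vector space: its rank function is the codimension
of the intersections. -/
def Matricube.IsRepresentable {m : ℕ} {r : Fin m → ℕ} (M : Matricube r)
    (k : Type u) [Field k] : Prop :=
  ∃ (V : Type u) (_ : AddCommGroup V) (_ : Module k V) (_ : FiniteDimensional k V)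
    (A : ∀ j : Fin m, InitialFlag k V (r j)),
    ∀ x : Hypercuboid r, M.rk x = Module.finrank k (V ⧸ (⨅ j : Fin m, (A j).F (x j)))

/-! ### Representable matroids -/

/-- The matroid is represented by a configuration of vectors in a `k`-vector space. -/
def IsRepresentableMatroid {α : Type*} (M : Matroid α) (k : Type u) [Field k] : Prop :=
  ∃ (V : Type u) (_ : AddCommGroup V) (_ : Module k V) (v : α → V),
    ∀ I : Set α, I ⊆ M.E → (M.Indep I ↔ LinearIndepOn k v I)

/-! ### The matroid given by a rank function -/

/-- A matroid rank function on the finite subsets of `α`. -/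
structure IsMatroidRank {α : Type*} [DecidableEq α] (f : Finset α → ℕ) : Prop where
  le_card : ∀ X, f X ≤ X.card
  mono : ∀ X Y, X ⊆ Y → f X ≤ f Y
  submod : ∀ X Y, f (X ∪ Y) + f (X ∩ Y) ≤ f X + f Y

namespace IsMatroidRank

variable {α : Type*} [DecidableEq α] {f : Finset α → ℕ}

theorem empty (h : IsMatroidRank f) : f ∅ = 0 := by
  simpa using h.le_card ∅

theorem indep_subset (h : IsMatroidRank f) {I J : Finset α} (hJ : f J = J.card) (hIJ : I ⊆ J) :
    f I = I.card := by
  have h1 := h.submod I (J \ I)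
  rw [Finset.union_sdiff_of_subset hIJ, Finset.inter_sdiff_self, h.empty] at h1
  have h2 := h.le_card (J \ I)
  have h3 := Finset.card_sdiff_add_card_eq_card hIJ
  have h4 := h.le_card I
  omega

theorem union_eq (h : IsMatroidRank f) (I J : Finset α) (hJ : ∀ e ∈ J, f (insert e I) = f I) :
    f (I ∪ J) = f I := by
  induction J using Finset.induction_on with
  | empty => simp
  | insert a J _ ih =>
    have ih' := ih fun e he => hJ e (Finset.mem_insert_of_mem he)
    have ha := hJ a (Finset.mem_insert_self a J)
    have h1 := h.submod (I ∪ J) (insert a I)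
    have h2 : (I ∪ J) ∪ insert a I = I ∪ insert a J := by
      ext x; simp only [Finset.mem_union, Finset.mem_insert]; tauto
    have h3 : f I ≤ f ((I ∪ J) ∩ insert a I) :=
      h.mono _ _ (Finset.subset_inter Finset.subset_union_left (Finset.subset_insert a I))
    have h4 : f I ≤ f (I ∪ insert a J) := h.mono _ _ Finset.subset_union_left
    rw [h2] at h1
    omega

theorem insert_eq (h : IsMatroidRank f) {I : Finset α} {e : α} (hI : f I = I.card)
    (he : f (insert e I) ≠ (insert e I).card) : f (insert e I) = f I := by
  have h1 := h.le_card (insert e I)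
  have h2 := Finset.card_insert_le e I
  have h3 := h.mono I (insert e I) (Finset.subset_insert e I)
  omega

theorem indep_aug (h : IsMatroidRank f) {I J : Finset α} (hI : f I = I.card) (hJ : f J = J.card)
    (hIJ : I.card < J.card) :
    ∃ e ∈ J, e ∉ I ∧ f (insert e I) = (insert e I).card := by
  by_contra! hc
  have h1 : f (I ∪ J) = f I := by
    refine h.union_eq I J fun e he => ?_
    by_cases heI : e ∈ I
    · rw [Finset.insert_eq_of_mem heI]
    · exact h.insert_eq hI (hc e he heI)
  have h2 := h.mono J (I ∪ J) Finset.subset_union_right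
  omega

/-- The matroid on `α` with rank function `f`: a finite set `I` is independent if and only if
`f I = |I|`. -/
def matroid (h : IsMatroidRank f) : Matroid α :=
  (IndepMatroid.ofFinset Set.univ (fun I : Finset α => f I = I.card)
    (by simpa using h.empty) (fun _ _ hJ hIJ => h.indep_subset hJ hIJ)
    (fun _ _ hI hJ hIJ => h.indep_aug hI hJ hIJ) (fun _ _ => Set.subset_univ _)).matroid

theorem matroid_ground (h : IsMatroidRank f) : h.matroid.E = Set.univ := rfl

theorem matroid_indep_iff (h : IsMatroidRank f) (I : Finset α) :
    h.matroid.Indep (I : Set α) ↔ f I = I.card := by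
  unfold matroid
  rw [IndepMatroid.matroid_indep_iff, IndepMatroid.ofFinset_indep]

/-- The rank function of `h.matroid` is indeed `f`. -/
theorem matroid_eRk (h : IsMatroidRank f) (Y : Finset α) :
    h.matroid.eRk (Y : Set α) = (f Y : ℕ∞) := by
  obtain ⟨B, hB⟩ := h.matroid.exists_isBasis (Y : Set α) (by rw [h.matroid_ground]; simp)
  obtain ⟨I, rfl⟩ : ∃ I : Finset α, (I : Set α) = B :=
    ⟨(Y.finite_toSet.subset hB.subset).toFinset, by simp⟩
  have hI := (h.matroid_indep_iff I).1 hB.indep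
  have hIY : I ⊆ Y := by exact_mod_cast hB.subset
  have h1 : f (I ∪ Y) = f I := by
    refine h.union_eq I Y fun e he => ?_
    by_cases heI : e ∈ I
    · rw [Finset.insert_eq_of_mem heI]
    · refine h.insert_eq hI fun hc => heI ?_
      have h2 : h.matroid.Indep (insert e (I : Set α)) := by
        have := (h.matroid_indep_iff (insert e I)).2 hc
        rwa [Finset.coe_insert] at this
      exact_mod_cast hB.mem_of_insert_indep (by exact_mod_cast he) h2
  rw [Finset.union_eq_right.2 hIY] at h1
  rw [hB.eRk_eq_encard, Set.encard_coe_eq_coe_finsetCard, h1, hI]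

end IsMatroidRank

/-! ### Integer polymatroids and their natural matroids -/

/-- An integer polymatroid on `E`, given by its rank function. -/
structure IntPolymatroid (E : Type*) [DecidableEq E] where
  rho : Finset E → ℕ
  rho_empty : rho ∅ = 0
  rho_mono : ∀ S T : Finset E, S ⊆ T → rho S ≤ rho T
  rho_submod : ∀ S T : Finset E, rho (S ∪ T) + rho (S ∩ T) ≤ rho S + rho T

namespace IntPolymatroid

variable {E : Type*} [DecidableEq E] [Fintype E]

/-- The set obtained from `E` by replacing each element `e` with `ρ({e})` copies of it. -/
abbrev Copies (P : IntPolymatroid E) : Type _ := Σ e : E, Fin (P.rho {e})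

/-- The set of all the copies of the elements of `S`. -/
def hat (P : IntPolymatroid E) (S : Finset E) : Finset P.Copies :=
  Finset.univ.filter fun x => x.1 ∈ S

/-- `ρ̂(Y) = min_{S ⊆ E} (ρ(S) + |Y \ Ŝ|)`. -/
def rhoHat (P : IntPolymatroid E) (Y : Finset P.Copies) : ℕ :=
  (Finset.univ : Finset (Finset E)).inf' Finset.univ_nonempty
    fun S => P.rho S + (Y \ P.hat S).card

theorem rhoHat_le (P : IntPolymatroid E) (Y : Finset P.Copies) (S : Finset E) :
    P.rhoHat Y ≤ P.rho S + (Y \ P.hat S).card :=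
  Finset.inf'_le (fun S => P.rho S + (Y \ P.hat S).card) (Finset.mem_univ S)

theorem exists_rhoHat_eq (P : IntPolymatroid E) (Y : Finset P.Copies) :
    ∃ S : Finset E, P.rhoHat Y = P.rho S + (Y \ P.hat S).card := by
  obtain ⟨S, -, hS⟩ := Finset.exists_mem_eq_inf' (s := (Finset.univ : Finset (Finset E)))
    Finset.univ_nonempty fun S => P.rho S + (Y \ P.hat S).card
  exact ⟨S, hS⟩

theorem isMatroidRank_rhoHat (P : IntPolymatroid E) : IsMatroidRank P.rhoHat where
  le_card Y := by
    have h := P.rhoHat_le Y ∅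
    rw [P.rho_empty, zero_add] at h
    exact h.trans (Finset.card_le_card Finset.sdiff_subset)
  mono X Y hXY := by
    obtain ⟨S, hS⟩ := P.exists_rhoHat_eq Y
    rw [hS]
    refine (P.rhoHat_le X S).trans (Nat.add_le_add_left (Finset.card_le_card ?_) _)
    exact Finset.sdiff_subset_sdiff hXY le_rfl
  submod X Y := by
    obtain ⟨S, hS⟩ := P.exists_rhoHat_eq X
    obtain ⟨T, hT⟩ := P.exists_rhoHat_eq Y
    have h1 := P.rhoHat_le (X ∪ Y) (S ∪ T)
    have h2 := P.rhoHat_le (X ∩ Y) (S ∩ T)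
    have h3 := P.rho_submod S T
    have h4 : ((X ∪ Y) \ P.hat (S ∪ T)).card + ((X ∩ Y) \ P.hat (S ∩ T)).card ≤
        (X \ P.hat S).card + (Y \ P.hat T).card := by
      rw [← Finset.card_union_add_card_inter (X \ P.hat S) (Y \ P.hat T),
        ← Finset.card_union_add_card_inter ((X ∪ Y) \ P.hat (S ∪ T))]
      refine Nat.add_le_add (Finset.card_le_card fun x hx => ?_)
        (Finset.card_le_card fun x hx => ?_) <;>
      · simp only [hat, Finset.mem_union, Finset.mem_inter, Finset.mem_sdiff, Finset.mem_filter,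
          Finset.mem_univ, true_and] at hx ⊢
        tauto
    omega

/-- The natural matroid of an integer polymatroid: the matroid on `P.Copies` with rank function
`P.rhoHat`. -/
def naturalMatroid (P : IntPolymatroid E) : Matroid P.Copies :=
  P.isMatroidRank_rhoHat.matroid

end IntPolymatroid

/-! ### The natural polymatroid and the natural matroid of a matricube -/

namespace Matricube

variable {m : ℕ} {r : Fin m → ℕ}

/-- The disjoint union of the intervals `{0, …, r j}`. -/
abbrev Intervals {m : ℕ} (r : Fin m → ℕ) : Type := Σ j : Fin m, Fin (r j + 1)

/-- The join in the hypercuboid of the points `t e_i`, for `(i, t) ∈ S`. -/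
noncomputable def join (S : Finset (Intervals r)) : Hypercuboid r :=
  S.sup fun a => (Pi.single a.1 a.2 : Hypercuboid r)

/-- The natural polymatroid of a matricube: `ρ(S)` is the rank of the join of `S`. -/
noncomputable def naturalPolymatroid (M : Matricube r) : IntPolymatroid (Intervals r) where
  rho S := M.rk (join S)
  rho_empty := M.rk_zero
  rho_mono _ _ h := M.rk_mono _ _ (Finset.sup_mono h)
  rho_submod S T := by
    have h1 := M.rk_submod (join S) (join T)
    have h2 : join (S ∪ T) = join S ⊔ join T := Finset.sup_union
    have h3 : M.rk (join (S ∩ T)) ≤ M.rk (join S ⊓ join T) :=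
      M.rk_mono _ _ (le_inf (Finset.sup_mono Finset.inter_subset_left)
        (Finset.sup_mono Finset.inter_subset_right))
    rw [h2]
    omega

/-- The natural matroid of a matricube. -/
noncomputable def naturalMatroid (M : Matricube r) : Matroid M.naturalPolymatroid.Copies :=
  M.naturalPolymatroid.naturalMatroid

end Matricube

end Matricubes

namespace Matricubes

/-! ### Vectors in general position -/

/-! Annihilators turn flags into increasing chains of subspaces and codimensions of intersections
into dimensions of sums. Thus representing the matricube amounts to finding subspaces `U e` whose
sums over `T` have dimension `ρ(T)`.

Given a representation of the natural matroid, take `U e` to be the span of the copies of `e`; this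
works over any field. Conversely, given the `U e`, choose for each copy of `e` a generic vector of
`U e`. The induction over copies needs a stronger invariant than `ρ̂`: adjoining `U e` for `e ∈ T`
to the span of the vectors in `Y` gives dimension `relRhoHat Y T`, which is `ρ(T)` at `Y = ∅` and
`ρ̂(Y)` at `T = ∅`. A new vector changes both sides by the same recurrence
(`finrank_span_singleton_sup`, `relRhoHat_insert`). Genericity means avoiding finitely many
subspaces, whose number is bounded in terms of `r` alone, so a large enough field suffices. -/

open scoped Pointwise in
/-- A vector space is not the union of fewer proper subspaces than there are scalars. -/
theorem exists_forall_notMem_of_card_lt {k V ι : Type*} [Field k] [AddCommGroup V] [Module k V]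
    (s : Finset ι) (p : ι → Submodule k V) (hp : ∀ i ∈ s, p i ≠ ⊤)
    (hk : Finite k → s.card < Nat.card k) : ∃ w : V, ∀ i ∈ s, w ∉ p i := by
  by_contra! hc
  have hcov : ⋃ i ∈ s, (0 : V) +ᵥ ((p i).toAddSubgroup : Set V) = Set.univ := by
    refine Set.eq_univ_of_forall fun w => ?_
    obtain ⟨i, hi, hw⟩ := hc w
    simpa only [zero_vadd, Set.mem_iUnion] using! ⟨i, hi, hw⟩
  -- B. H. Neumann's lemma: some `p i` has index at most `s.card`. Its nonzero quotient contains a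
  -- line, hence at least `Nat.card k` elements.
  obtain ⟨i, hi, hfi, hle⟩ := AddSubgroup.exists_index_le_card_of_leftCoset_cover hcov
  have : Finite (V ⧸ p i) := AddSubgroup.finite_quotient_of_finiteIndex
  have : Nontrivial (V ⧸ p i) := Submodule.Quotient.nontrivial_iff.mpr (hp i hi)
  obtain ⟨x, hx⟩ := exists_ne (0 : V ⧸ p i)
  have hinj : Function.Injective fun c : k => c • x := smul_left_injective k hx
  have h1 := hk (Finite.of_injective _ hinj)
  have h2 := Nat.card_le_card_of_injective _ hinj
  have h3 : Nat.card (V ⧸ p i) = (p i).toAddSubgroup.index := rfl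
  omega

/-- A subspace contains a vector that lies in a given one of finitely many subspaces only if that
subspace contains it entirely. -/
theorem exists_mem_generic {k V ι : Type*} [Field k] [AddCommGroup V] [Module k V]
    (U : Submodule k V) (s : Finset ι) (p : ι → Submodule k V)
    (hk : Finite k → s.card < Nat.card k) : ∃ w ∈ U, ∀ i ∈ s, w ∈ p i → U ≤ p i := by
  -- Subspaces containing `U` impose no condition; the others meet `U` in proper subspaces.
  classical
  obtain ⟨w, hw⟩ := exists_forall_notMem_of_card_lt (s.filter fun i => ¬ U ≤ p i)
    (fun i => (p i).comap U.subtype)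
    (fun i hi h => (Finset.mem_filter.1 hi).2 (Submodule.comap_subtype_eq_top.1 h))
    (fun h => (Finset.card_filter_le _ _).trans_lt (hk h))
  refine ⟨w, w.2, fun i hi hwi => ?_⟩
  by_contra hU
  exact hw i (Finset.mem_filter.2 ⟨hi, hU⟩) hwi

/-- A generic `w` raises the dimension by one unless `U ≤ W`; these two cases are the two terms of
the minimum. -/
theorem finrank_span_singleton_sup {k V : Type*} [Field k] [AddCommGroup V] [Module k V]
    [FiniteDimensional k V] (W U : Submodule k V) {w : V} (hw : w ∈ U) (h : w ∈ W → U ≤ W) :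
    Module.finrank k ↥(Submodule.span k {w} ⊔ W) =
      min (Module.finrank k W + 1) (Module.finrank k ↥(U ⊔ W)) := by
  have hsp : Submodule.span k {w} ≤ U := by simpa using hw
  by_cases hwW : w ∈ W
  · have h1 : Submodule.span k {w} ≤ W := by simpa using hwW
    rw [sup_eq_right.2 h1, sup_eq_right.2 (h hwW)]
    omega
  · have h1 : W < Submodule.span k {w} ⊔ W := by
      refine lt_of_le_of_ne le_sup_right fun he => hwW ?_
      rw [he]
      exact Submodule.mem_sup_left (Submodule.mem_span_singleton_self w)
    have h2 := Submodule.finrank_lt_finrank_of_lt h1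
    have h3 : Module.finrank k ↥(Submodule.span k {w} ⊔ W) ≤ Module.finrank k ↥(U ⊔ W) :=
      Submodule.finrank_mono (sup_le_sup_right hsp W)
    have h4 := Submodule.finrank_add_le_finrank_add_finrank (Submodule.span k {w}) W
    have h5 : Module.finrank k (Submodule.span k {w}) ≤ 1 := by
      simpa using finrank_span_le_card (R := k) ({w} : Set V)
    omega

theorem linearIndepOn_iff_finrank_span {k V α : Type*} [Field k] [AddCommGroup V] [Module k V]
    (v : α → V) (I : Finset α) :
    LinearIndepOn k v (I : Set α) ↔
      Module.finrank k (Submodule.span k (v '' (I : Set α))) = I.card := by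
  unfold LinearIndepOn
  rw [linearIndependent_iff_card_eq_finrank_span, Set.finrank, Set.image_eq_range]
  simp [eq_comm]

/-! ### Subspace representations of an integer polymatroid and of its natural matroid -/

namespace IntPolymatroid

variable {E : Type*} [DecidableEq E]

theorem rho_union_le (P : IntPolymatroid E) (S T : Finset E) :
    P.rho (T ∪ S) ≤ P.rho T + ∑ e ∈ S, P.rho {e} := by
  induction S using Finset.induction_on with
  | empty => simp
  | insert a S ha ih =>
    have h1 := P.rho_submod (T ∪ S) {a}
    rw [Finset.sum_insert ha]
    have h2 : (T ∪ S) ∪ {a} = T ∪ insert a S := by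
      ext x; simp only [Finset.mem_union, Finset.mem_insert, Finset.mem_singleton]; tauto
    rw [h2] at h1
    omega

variable [Fintype E]

theorem mem_hat (P : IntPolymatroid E) (S : Finset E) (y : P.Copies) : y ∈ P.hat S ↔ y.1 ∈ S := by
  simp [hat]

/-- The minimum of `ρ(S) + |Y \ Ŝ|` over the subsets `S` that contain `T`. -/
def relRhoHat (P : IntPolymatroid E) (Y : Finset P.Copies) (T : Finset E) : ℕ :=
  (Finset.univ : Finset (Finset E)).inf' Finset.univ_nonempty
    fun S => P.rho (T ∪ S) + (Y \ P.hat (T ∪ S)).card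

theorem relRhoHat_le (P : IntPolymatroid E) (Y : Finset P.Copies) {S T : Finset E} (h : T ⊆ S) :
    P.relRhoHat Y T ≤ P.rho S + (Y \ P.hat S).card := by
  have := Finset.inf'_le (fun S => P.rho (T ∪ S) + (Y \ P.hat (T ∪ S)).card) (Finset.mem_univ S)
  rwa [Finset.union_eq_right.2 h] at this

theorem exists_relRhoHat_eq (P : IntPolymatroid E) (Y : Finset P.Copies) (T : Finset E) :
    ∃ S, T ⊆ S ∧ P.relRhoHat Y T = P.rho S + (Y \ P.hat S).card := by
  obtain ⟨S, -, hS⟩ := Finset.exists_mem_eq_inf' (s := (Finset.univ : Finset (Finset E)))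
    Finset.univ_nonempty fun S => P.rho (T ∪ S) + (Y \ P.hat (T ∪ S)).card
  exact ⟨T ∪ S, Finset.subset_union_left, hS⟩

theorem relRhoHat_empty_right (P : IntPolymatroid E) (Y : Finset P.Copies) :
    P.relRhoHat Y ∅ = P.rhoHat Y := by
  simp [relRhoHat, rhoHat]

theorem relRhoHat_empty_left (P : IntPolymatroid E) (T : Finset E) :
    P.relRhoHat ∅ T = P.rho T := by
  obtain ⟨S, hTS, hS⟩ := P.exists_relRhoHat_eq ∅ T
  have h1 := P.relRhoHat_le ∅ (Finset.Subset.refl T)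
  have h2 := P.rho_mono T S hTS
  simp only [Finset.empty_sdiff, Finset.card_empty] at hS h1
  omega

/-- Sort the competing sets `S ⊇ T` by whether they contain `y.1`: if so, `y` costs nothing;
otherwise it costs one. -/
theorem relRhoHat_insert (P : IntPolymatroid E) {Y : Finset P.Copies} {y : P.Copies} (hy : y ∉ Y)
    (T : Finset E) : P.relRhoHat (insert y Y) T =
      min (P.relRhoHat Y T + 1) (P.relRhoHat Y (insert y.1 T)) := by
  have hin : ∀ S : Finset E, y.1 ∈ S → (insert y Y) \ P.hat S = Y \ P.hat S := fun S hS =>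
    Finset.insert_sdiff_of_mem _ ((P.mem_hat S y).2 hS)
  have hout : ∀ S : Finset E, y.1 ∉ S →
      ((insert y Y) \ P.hat S).card = (Y \ P.hat S).card + 1 := fun S hS => by
    rw [Finset.insert_sdiff_of_notMem _ (fun h => hS ((P.mem_hat S y).1 h)),
      Finset.card_insert_of_notMem (fun h => hy (Finset.mem_sdiff.1 h).1)]
  refine le_antisymm (le_min ?_ ?_) ?_
  · obtain ⟨S, hTS, hS⟩ := P.exists_relRhoHat_eq Y T
    have h1 := P.relRhoHat_le (insert y Y) hTS
    by_cases hyS : y.1 ∈ S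
    · rw [hin S hyS] at h1
      omega
    · rw [hout S hyS] at h1
      omega
  · obtain ⟨S, hTS, hS⟩ := P.exists_relRhoHat_eq Y (insert y.1 T)
    have h1 := P.relRhoHat_le (insert y Y) ((Finset.subset_insert _ _).trans hTS)
    rwa [hin S (hTS (Finset.mem_insert_self _ _)), ← hS] at h1
  · obtain ⟨S, hTS, hS⟩ := P.exists_relRhoHat_eq (insert y Y) T
    by_cases hyS : y.1 ∈ S
    · have h1 := P.relRhoHat_le Y (Finset.insert_subset hyS hTS)
      rw [hin S hyS] at hS
      omega
    · have h1 := P.relRhoHat_le Y hTS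
      rw [hout S hyS] at hS
      omega

theorem card_hat_sdiff_hat (P : IntPolymatroid E) (S T : Finset E) :
    (P.hat S \ P.hat T).card = ∑ e ∈ S \ T, P.rho {e} := by
  have : P.hat S \ P.hat T = (S \ T).sigma fun _ => Finset.univ := by
    ext y
    simp [mem_hat]
  rw [this, Finset.card_sigma]
  simp

/-- The set `S` itself attains the minimum: each element of `S` missing from `T` costs `ρ({e})`
copies, which by subadditivity pays for adding it to `T`. -/
theorem rhoHat_hat (P : IntPolymatroid E) (S : Finset E) : P.rhoHat (P.hat S) = P.rho S := by
  refine le_antisymm (by simpa using P.rhoHat_le (P.hat S) S) ?_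
  obtain ⟨T, hT⟩ := P.exists_rhoHat_eq (P.hat S)
  rw [hT, card_hat_sdiff_hat]
  refine (P.rho_mono _ _ ?_).trans (P.rho_union_le (S \ T) T)
  rw [Finset.union_sdiff_self_eq_union]
  exact Finset.subset_union_right

/-- Vectors chosen in general position in the subspaces `U e` realize the natural matroid. -/
theorem exists_generic_vectors (P : IntPolymatroid E) {k V : Type*} [Field k] [AddCommGroup V]
    [Module k V] [FiniteDimensional k V] (U : E → Submodule k V)
    (hU : ∀ T : Finset E, Module.finrank k ↥(T.sup U) = P.rho T)
    (hk : Finite k → 2 ^ (Fintype.card P.Copies + Fintype.card E) < Nat.card k)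
    (Z : Finset P.Copies) :
    ∃ v : P.Copies → V, ∀ Y ⊆ Z, ∀ T : Finset E,
      Module.finrank k ↥(Submodule.span k (v '' (Y : Set P.Copies)) ⊔ T.sup U) =
        P.relRhoHat Y T := by
  induction Z using Finset.induction_on with
  | empty =>
    refine ⟨0, fun Y hY T => ?_⟩
    obtain rfl := Finset.subset_empty.1 hY
    rw [relRhoHat_empty_left, Finset.coe_empty, Set.image_empty, Submodule.span_empty, bot_sup_eq,
      hU T]
  | insert y Z hy ih =>
    obtain ⟨v, hv⟩ := ih
    -- One subspace to avoid for each pair of a subset of `Z` and a subset of `E`, whence the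
    -- exponent in `hk`.
    obtain ⟨w, hwU, hw⟩ := exists_mem_generic (U y.1)
      (Z.powerset ×ˢ (Finset.univ : Finset (Finset E)))
      (fun a => Submodule.span k (v '' (a.1 : Set P.Copies)) ⊔ a.2.sup U) (fun h => by
        refine lt_of_le_of_lt ?_ (hk h)
        rw [Finset.card_product, Finset.card_powerset, Finset.card_univ, Fintype.card_finset,
          pow_add]
        exact Nat.mul_le_mul_right _
          (Nat.pow_le_pow_right two_pos (Finset.card_le_univ Z)))
    have hupd : ∀ Y ⊆ Z, Function.update v y w '' (Y : Set P.Copies) = v '' (Y : Set P.Copies) :=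
      fun Y hY => Set.image_congr fun x hx =>
        Function.update_of_ne (fun h : x = y => hy (hY (by simpa [h] using hx))) _ _
    refine ⟨Function.update v y w, fun Y hY T => ?_⟩
    by_cases hyY : y ∈ Y
    · obtain ⟨Y', hyY', rfl⟩ : ∃ Y', y ∉ Y' ∧ insert y Y' = Y :=
        ⟨Y.erase y, Finset.notMem_erase _ _, Finset.insert_erase hyY⟩
      have hY' : Y' ⊆ Z := (Finset.insert_subset_insert_iff hyY').1 hY
      rw [Finset.coe_insert, Set.image_insert_eq, Function.update_self, hupd Y' hY',
        Submodule.span_insert, sup_assoc, P.relRhoHat_insert hyY', ← hv Y' hY', ← hv Y' hY',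
        finrank_span_singleton_sup _ (U y.1) hwU
          (hw (Y', T) (Finset.mem_product.2 ⟨Finset.mem_powerset.2 hY', Finset.mem_univ _⟩)),
        Finset.sup_insert, sup_left_comm]
    · have hYZ : Y ⊆ Z := (Finset.subset_insert_iff_of_notMem hyY).1 hY
      rw [hupd Y hYZ, hv Y hYZ]

theorem isRepresentableMatroid_naturalMatroid (P : IntPolymatroid E) {k V : Type u} [Field k]
    [AddCommGroup V] [Module k V] [FiniteDimensional k V] (U : E → Submodule k V)
    (hU : ∀ T : Finset E, Module.finrank k ↥(T.sup U) = P.rho T)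
    (hk : Finite k → 2 ^ (Fintype.card P.Copies + Fintype.card E) < Nat.card k) :
    IsRepresentableMatroid P.naturalMatroid k := by
  obtain ⟨v, hv⟩ := P.exists_generic_vectors U hU hk Finset.univ
  refine ⟨V, inferInstance, inferInstance, v, fun I _ => ?_⟩
  obtain ⟨J, rfl⟩ : ∃ J : Finset P.Copies, (J : Set P.Copies) = I :=
    ⟨I.toFinite.toFinset, by simp⟩
  have h := hv J (Finset.subset_univ J) ∅
  rw [Finset.sup_empty, sup_bot_eq, relRhoHat_empty_right] at h
  rw [naturalMatroid, IsMatroidRank.matroid_indep_iff, linearIndepOn_iff_finrank_span, h]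

/-- A representation of the natural matroid gives subspaces that represent the polymatroid. -/
theorem finrank_sup_span_copies (P : IntPolymatroid E) {k V : Type*} [Field k] [AddCommGroup V]
    [Module k V] {v : P.Copies → V}
    (hv : ∀ I : Set P.Copies, P.naturalMatroid.Indep I ↔ LinearIndepOn k v I) (S : Finset E) :
    Module.finrank k ↥(S.sup fun e => Submodule.span k (Set.range fun i => v ⟨e, i⟩)) =
      P.rho S := by
  have hspan : (S.sup fun e => Submodule.span k (Set.range fun i => v ⟨e, i⟩)) =
      Submodule.span k (v '' (P.hat S : Set P.Copies)) := by
    refine le_antisymm (Finset.sup_le fun e he => Submodule.span_mono ?_) ?_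
    · rintro _ ⟨i, rfl⟩
      exact ⟨⟨e, i⟩, by simpa [mem_hat] using he, rfl⟩
    · rw [Submodule.span_le]
      rintro _ ⟨⟨e, i⟩, hi, rfl⟩
      have he : e ∈ S := (P.mem_hat S _).1 hi
      exact Finset.le_sup (f := fun e => Submodule.span k (Set.range fun i => v ⟨e, i⟩)) he
        (Submodule.subset_span ⟨i, rfl⟩)
  rw [hspan, ← P.rhoHat_hat S]
  obtain ⟨B, hB⟩ := P.naturalMatroid.exists_isBasis (P.hat S : Set P.Copies)
    (Set.subset_univ _)
  obtain ⟨I, rfl⟩ : ∃ I : Finset P.Copies, (I : Set P.Copies) = B :=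
    ⟨B.toFinite.toFinset, by simp⟩
  have h1 : P.naturalMatroid.eRk (P.hat S : Set P.Copies) = (P.rhoHat (P.hat S) : ℕ∞) :=
    P.isMatroidRank_rhoHat.matroid_eRk _
  rw [hB.eRk_eq_encard, Set.encard_coe_eq_coe_finsetCard, Nat.cast_inj] at h1
  have hI := (hv I).1 hB.indep
  have h2 : Submodule.span k (v '' (P.hat S : Set P.Copies)) =
      Submodule.span k (v '' (I : Set P.Copies)) := by
    -- A vector outside the span of the basis would extend it to a larger independent subset of
    -- `P.hat S`.
    refine le_antisymm (Submodule.span_le.2 ?_) (Submodule.span_mono (Set.image_mono hB.subset))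
    rintro _ ⟨y, hy, rfl⟩
    by_contra hc
    have h3 : LinearIndepOn k v (insert y (I : Set P.Copies)) := hI.insert hc
    have h4 := hB.mem_of_insert_indep hy ((hv _).2 h3)
    exact hc (Submodule.subset_span ⟨y, h4, rfl⟩)
  rw [h2, (linearIndepOn_iff_finrank_span v I).1 hI, h1]

end IntPolymatroid

/-! ### Flag arrangements -/

namespace InitialFlag

variable {k V : Type*} [Field k] [AddCommGroup V] [Module k V] {ℓ : ℕ}

theorem antitone (A : InitialFlag k V ℓ) : Antitone A.F :=
  Fin.antitone_iff_succ_le.2 A.succ_le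

end InitialFlag

/-! ### Duality between flags and increasing chains of subspaces -/

namespace Matricube

variable {m : ℕ} {r : Fin m → ℕ}

theorem iInf_flag_join {k V : Type*} [Field k] [AddCommGroup V] [Module k V]
    (A : ∀ j : Fin m, InitialFlag k V (r j)) (S : Finset (Intervals r)) :
    ⨅ j, (A j).F (join S j) = S.inf fun a => (A a.1).F a.2 := by
  induction S using Finset.induction_on with
  | empty =>
    simp only [join, Finset.sup_empty, Finset.inf_empty]
    exact iInf_eq_top.2 fun j => (A j).zero_eq
  | insert a S ha ih =>
    have h1 : join (insert a S) = Pi.single a.1 a.2 ⊔ join S := Finset.sup_insert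
    have h2 : ∀ j, (A j).F (join (insert a S) j) =
        (A j).F ((Pi.single a.1 a.2 : Hypercuboid r) j) ⊓ (A j).F (join S j) := fun j => by
      rw [h1, Pi.sup_apply]
      exact (A j).antitone.map_sup _ _
    have h3 : ⨅ j, (A j).F ((Pi.single a.1 a.2 : Hypercuboid r) j) = (A a.1).F a.2 := by
      refine le_antisymm ((iInf_le _ a.1).trans (by rw [Pi.single_eq_same])) (le_iInf fun j => ?_)
      by_cases hj : j = a.1
      · subst hj
        rw [Pi.single_eq_same]
      · rw [Pi.single_eq_of_ne hj, (A j).zero_eq]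
        exact le_top
    rw [Finset.inf_insert, ← ih, ← h3, ← iInf_inf_eq]
    exact iInf_congr h2

/-- Every point is a join of axis points, so the natural polymatroid determines the whole rank
function. -/
theorem join_graph (x : Hypercuboid r) :
    join (Finset.univ.image fun j => (⟨j, x j⟩ : Intervals r)) = x := by
  refine le_antisymm (Finset.sup_le fun a ha => ?_) fun j => ?_
  · obtain ⟨j, -, rfl⟩ := Finset.mem_image.1 ha
    intro i
    by_cases hi : i = j
    · subst hi
      simp
    · simp [Pi.single_eq_of_ne hi]
  · have h : (Pi.single j (x j) : Hypercuboid r) ≤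
        join (Finset.univ.image fun j => (⟨j, x j⟩ : Intervals r)) :=
      Finset.le_sup (f := fun a : Intervals r => (Pi.single a.1 a.2 : Hypercuboid r))
        (Finset.mem_image_of_mem (fun j => (⟨j, x j⟩ : Intervals r)) (Finset.mem_univ j))
    simpa using h j

theorem join_singleton (a : Intervals r) : join {a} = Pi.single a.1 a.2 :=
  Finset.sup_singleton

theorem rk_single_le (M : Matricube r) (i : Fin m) (t : Fin (r i + 1)) :
    M.rk (Pi.single i t) ≤ t := by
  induction t using Fin.induction with
  | zero => simp [M.rk_zero]
  | succ t ih =>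
    have := M.rk_step i t
    simp only [Fin.val_succ, Fin.val_castSucc] at ih ⊢
    omega

/-- Bounds the number of copies independently of `M`, so that one `N` serves all matricubes of width
`r`. -/
theorem card_copies_le (M : Matricube r) :
    Fintype.card M.naturalPolymatroid.Copies ≤ ∑ a : Intervals r, (a.2 : ℕ) := by
  rw [Fintype.card_sigma]
  refine Finset.sum_le_sum fun a _ => ?_
  rw [Fintype.card_fin]
  change M.rk (join {a}) ≤ _
  rw [join_singleton]
  exact M.rk_single_le a.1 a.2

theorem isRepresentableMatroid_of_isRepresentable (M : Matricube r) {k : Type u} [Field k]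
    (hk : Finite k →
      2 ^ ((∑ a : Intervals r, (a.2 : ℕ)) + Fintype.card (Intervals r)) < Nat.card k)
    (h : M.IsRepresentable k) : IsRepresentableMatroid M.naturalMatroid k := by
  obtain ⟨V, _, _, _, A, hA⟩ := h
  refine M.naturalPolymatroid.isRepresentableMatroid_naturalMatroid
    (fun a => ((A a.1).F a.2).dualAnnihilator) (fun T => ?_) (fun hfin =>
      (Nat.pow_le_pow_right two_pos (Nat.add_le_add_right M.card_copies_le _)).trans_lt (hk hfin))
  have h1 : (T.sup fun a => ((A a.1).F a.2).dualAnnihilator) =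
      (T.inf fun a => (A a.1).F a.2).dualAnnihilator := by
    induction T using Finset.induction_on with
    | empty => simp
    | insert a T ha ih =>
      rw [Finset.sup_insert, Finset.inf_insert, ih, Subspace.dualAnnihilator_inf_eq]
  change _ = M.rk (join T)
  rw [h1, hA, iInf_flag_join]
  have h2 := Subspace.finrank_add_finrank_dualAnnihilator_eq (T.inf fun a => (A a.1).F a.2)
  have h3 := Submodule.finrank_quotient_add_finrank (T.inf fun a => (A a.1).F a.2)
  omega

/-- Increasing chains of proper subspaces representing the natural polymatroid give, by duality,
flags representing the matricube. -/
theorem isRepresentable_of_subspaces (M : Matricube r) {k W : Type u} [Field k] [AddCommGroup W]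
    [Module k W] [FiniteDimensional k W] (U : Intervals r → Submodule k W)
    (hU : ∀ S : Finset (Intervals r), Module.finrank k ↥(S.sup U) = M.rk (join S))
    (htop : ∀ a, U a ≠ ⊤) : M.IsRepresentable k := by
  have hU1 : ∀ a, Module.finrank k (U a) = M.rk (Pi.single a.1 a.2) := fun a => by
    have := hU {a}
    rwa [Finset.sup_singleton, join_singleton] at this
  have hmono : ∀ (j : Fin m) (t : Fin (r j)), U ⟨j, t.castSucc⟩ ≤ U ⟨j, t.succ⟩ := fun j t => by
    have h1 := hU {⟨j, t.castSucc⟩, ⟨j, t.succ⟩}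
    have h2 : join ({⟨j, t.castSucc⟩, ⟨j, t.succ⟩} : Finset (Intervals r)) =
        Pi.single j t.succ := by
      rw [join, Finset.sup_insert, Finset.sup_singleton, sup_eq_right]
      exact Pi.single_mono j Fin.castSucc_lt_succ.le
    rw [h2, ← hU1 ⟨j, t.succ⟩, Finset.sup_insert, Finset.sup_singleton] at h1
    exact le_sup_left.trans (Submodule.eq_of_le_of_finrank_eq le_sup_right h1.symm).ge
  have hdim : ∀ a, Module.finrank k (U a) + Module.finrank k (U a).dualAnnihilator =
    Module.finrank k W := fun a => Subspace.finrank_add_finrank_dualAnnihilator_eq (U a)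
  let A : ∀ j : Fin m, InitialFlag k (Module.Dual k W) (r j) := fun j =>
    { F := fun t => (U ⟨j, t⟩).dualAnnihilator
      zero_eq := by
        have h := hU1 ⟨j, 0⟩
        rw [Pi.single_zero, M.rk_zero, Submodule.finrank_eq_zero] at h
        rw [h, Submodule.dualAnnihilator_bot]
      succ_le := fun t => Submodule.dualAnnihilator_anti (hmono j t)
      codim_le := fun t => by
        have h1 := hdim ⟨j, t.castSucc⟩
        have h2 := hdim ⟨j, t.succ⟩
        have h3 := M.rk_step j t
        rw [hU1] at h1 h2
        dsimp only at h1 h2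
        omega
      last_ne := fun h => htop ⟨j, Fin.last _⟩ (by
        rw [← Subspace.dualAnnihilator_inj, h, Submodule.dualAnnihilator_top]) }
  refine ⟨Module.Dual k W, inferInstance, inferInstance, inferInstance, A, fun x => ?_⟩
  have h1 : ⨅ j, (A j).F (x j) = (⨆ j, U ⟨j, x j⟩).dualAnnihilator :=
    (Submodule.dualAnnihilator_iSup_eq _).symm
  have h2 := hU (Finset.univ.image fun j => (⟨j, x j⟩ : Intervals r))
  rw [join_graph, Finset.sup_image, Finset.sup_univ_eq_iSup] at h2
  rw [h1, ← h2]
  have h3 := Subspace.finrank_add_finrank_dualAnnihilator_eq (⨆ j, U ⟨j, x j⟩)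
  have h4 := Submodule.finrank_quotient_add_finrank (⨆ j, U ⟨j, x j⟩).dualAnnihilator
  rw [Subspace.dual_finrank_eq] at h4
  change Module.finrank k ↥(⨆ j, U ⟨j, x j⟩) = _
  omega

theorem isRepresentable_of_isRepresentableMatroid (M : Matricube r) {k : Type u} [Field k]
    (h : IsRepresentableMatroid M.naturalMatroid k) : M.IsRepresentable k := by
  obtain ⟨V, _, _, v, hv⟩ := h
  let W := Submodule.span k (Set.range v)
  have : FiniteDimensional k W := FiniteDimensional.span_of_finite k (Set.finite_range v)
  -- The extra coordinate, always zero, keeps every span proper, so that the dual flags end in a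
  -- nonzero subspace.
  let w : M.naturalPolymatroid.Copies → W × k := fun y => (⟨v y, Submodule.subset_span ⟨y, rfl⟩⟩, 0)
  have hw : ∀ I : Set M.naturalPolymatroid.Copies,
      M.naturalPolymatroid.naturalMatroid.Indep I ↔ LinearIndepOn k w I := fun I => by
    have h1 : LinearIndepOn k (fun y => (w y).1) I ↔ LinearIndepOn k v I :=
      (LinearMap.linearIndependent_iff W.subtype W.ker_subtype).symm
    have h2 : LinearIndepOn k w I ↔ LinearIndepOn k (fun y => (w y).1) I :=
      LinearMap.linearIndependent_iff (v := fun y : I => (w y).1) (LinearMap.inl k W k)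
        (LinearMap.ker_eq_bot.2 LinearMap.inl_injective)
    exact (hv I (Set.subset_univ I)).trans (h2.trans h1).symm
  refine M.isRepresentable_of_subspaces (W := W × k)
    (fun a => Submodule.span k (Set.range fun i => w ⟨a, i⟩))
    (fun S => M.naturalPolymatroid.finrank_sup_span_copies hw S) (fun a ha => ?_)
  have h1 : Submodule.span k (Set.range fun i => w ⟨a, i⟩) ≤
      LinearMap.ker (LinearMap.snd k W k) := by
    rw [Submodule.span_le]
    rintro _ ⟨i, rfl⟩
    exact LinearMap.mem_ker.2 rfl
  have h2 : ((0 : W), (1 : k)) ∈ LinearMap.ker (LinearMap.snd k W k) := h1 (ha ▸ Submodule.mem_top)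
  exact one_ne_zero (LinearMap.mem_ker.1 h2)

end Matricube

end Matricubes

theorem mainTheorem4 {m : ℕ} (r : Fin m → ℕ) :
    (∀ (M : Matricubes.Matricube r) (k : Type u) [Field k] [Infinite k],
      M.IsRepresentable k ↔ Matricubes.IsRepresentableMatroid M.naturalMatroid k) ∧
    (∃ N : ℕ, ∀ (M : Matricubes.Matricube r) (k : Type u) [Field k] [Finite k],
      N ≤ Nat.card k →
        (M.IsRepresentable k ↔ Matricubes.IsRepresentableMatroid M.naturalMatroid k)) := by
  refine ⟨fun M k _ _ => ⟨M.isRepresentableMatroid_of_isRepresentable fun h =>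
    (not_finite k).elim, M.isRepresentable_of_isRepresentableMatroid⟩, ?_⟩
  -- Unification with the strict bound makes `N` one more than the power of two.
  exact ⟨_, fun M k _ _ hN => ⟨M.isRepresentableMatroid_of_isRepresentable fun _ => hN,
    M.isRepresentable_of_isRepresentableMatroid⟩⟩
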